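/- \textbf{Conventions.} All valued fields have characteristic $0$, and all valuation rings are proper subrings. For a valued field $(K,v)$ write $\mathcal O$, $\mathcal M$, $vK$, $\overline K$ for its valuation ring, maximal ideal, value group and residue field. The language $\mathcal L_{Mac}$ is the language of rings $\{+,-,\cdot,0,1\}$ together with a unary predicate for $\mathcal O$ and unary predicates $P_n$ ($n>1$), interpreted in $K$ as the sets of nonzero $n$-th powers. $(K,v)$ \emph{admits QE in $\mathcal L_{Mac}$} if every $\mathcal L_{Mac}$-formula is equivalent, modulo the complete theory of $(K,v)$, to a quantifier-free one in the same free variables. A subgroup $H$ of an ordered abelian group is \emph{convex} if $0\le a\le b$ with $b\in H$ implies $a\in H$. A valuation is of \emph{rank $1$} if $\{0\}$ is the only proper convex subgroup of its value group. For $r,t\in\mathcal O$ call $r,t$ \emph{comparable} if for some $n\ge 1$ either $v(r^n)\le v(t)\le v(r^{n+1})$ or $v(t^n)\le v(r)\le v(t^{n+1})$; write $r\ll t$ if $r,t$ are not comparable and $v(r)<v(t)$. For $A\subseteq K$ let $\mathbb Q(A)^K$ be the relative algebraic closure in $K$ of the subfield of $K$ generated by $A$. An element $t\in A$ is a \emph{cofinal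 element} in $A$ if for every nonzero $r\in A$ there is $n\in\mathbb N$ with $v(r)\le n\,v(t)$. $(K,v)$ is of \emph{prohenselian degree $n$} if for all $1\le m\le n$ and all $t_1,\dots,t_m\in\mathcal M$ with $t_1\ll\dots\ll t_m$ the valuation ring $\mathbb Q(t_1,\dots,t_m)^K\cap\mathcal O$ of $\mathbb Q(t_1,\dots,t_m)^K$ admits a henselian coarsening, that is, is contained in a henselian valuation ring that is a proper subring of $\mathbb Q(t_1,\dots,t_m)^K$. (For $n=1$: for every $t\in\mathcal M$, the ring $\mathbb Q(t)^K\cap\mathcal O$ admits a henselian coarsening.) Let $\operatorname{char}\overline K=p>0$. $(K,v)$ is \emph{tight} if $vK$ has a smallest nonzero convex subgroup and it contains $v(p)$. A subgroup $C$ of $K^\times$ with $\mathbb Q^\times\subseteq C$ is \emph{conservative} if (1) $p$ is a cofinal element in $\mathbb Q(r)^K$ for every $r\in C$, and (2) $C$ is an existentially closed substructure of $K^\times$ over $\mathbb Q^\times$ in the language of groups, that is, every existential formula of the language of groups with parameters in $\mathbb Q^\times$ that holds in $K^\times$ holds in $C$. \textbf{Theorem.} Let $(K,v)$ be a valued field with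 residue characteristic $p>0$ that admits QE in $\mathcal L_{Mac}$, is of prohenselian degree $1$, is tight, and for which $K^\times$ has a conservative subgroup. Then there is a valued field $(L,w)$ such that $w$ is of rank $1$ and $(L,w)\equiv(K,v)$ as structures of $\mathcal L_{Mac}$. -/

import Mathlib

open FirstOrder

universe u

noncomputable section

/-! ### The Macintyre language -/

/-- The relation symbols of the Macintyre language: a unary predicate for the valuation ring and
unary predicates `P_n` for all `n > 1`. -/
inductive MacRel : ℕ → Type
  | valRing : MacRel 1
  | pow (n : ℕ) (hn : 1 < n) : MacRel 1

/-- The Macintyre language: the language of rings together with the predicates `MacRel`. -/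
def macLang : Language := ⟨ringFunc, MacRel⟩

/-- The interpretation of the relation symbols in the valued field `(K, A)`; `P_n` is the set of
nonzero `n`-th powers. -/
def macRelMap {K : Type*} [Field K] (A : ValuationSubring K) :
    ∀ {n : ℕ}, MacRel n → (Fin n → K) → Prop
  | _, .valRing, x => x 0 ∈ A
  | _, .pow n _, x => x 0 ≠ 0 ∧ ∃ y : K, y ^ n = x 0

/-- The valued field `(K, A)` as a structure of the Macintyre language. -/
@[reducible] def macStructure {K : Type*} [Field K] (A : ValuationSubring K) :
    macLang.Structure K where
  funMap := fun f x => (Ring.compatibleRingOfRing K).funMap f x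
  RelMap := fun r x => macRelMap A r x

/-- The complete theory of the valued field `(K, A)` in the Macintyre language. -/
def macTheory {K : Type*} [Field K] (A : ValuationSubring K) : macLang.Theory :=
  letI := macStructure A
  macLang.completeTheory K

/-- Elementary equivalence of valued fields as structures of the Macintyre language. -/
def MacEquiv {K L : Type*} [Field K] [Field L] (A : ValuationSubring K)
    (B : ValuationSubring L) : Prop :=
  letI := macStructure A
  letI := macStructure B
  macLang.ElementarilyEquivalent K L

/-- The theory `T` admits quantifier elimination: modulo `T`, every formula is equivalent to a
quantifier-free formula in the same free variables. -/
def HasQE {L : Language} (T : L.Theory) : Prop :=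
  ∀ (n : ℕ) (φ : L.Formula (Fin n)), ∃ ψ : L.Formula (Fin n),
    Language.BoundedFormula.IsQF ψ ∧ Language.Theory.Iff T φ ψ

/-! ### Convex subgroups and rank -/

/-- Convexity of a subgroup of a (multiplicatively written) ordered abelian group. -/
def IsConvexSubgroup {G : Type*} [CommGroup G] [LinearOrder G] (H : Subgroup G) : Prop :=
  ∀ a b : G, b ∈ H → 1 ≤ a → a ≤ b → a ∈ H

/-- An ordered abelian group is of rank `1` if the trivial subgroup is its only proper convex
subgroup. -/
def IsRankOneGroup (G : Type*) [CommGroup G] [LinearOrder G] : Prop :=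
  ∀ H : Subgroup G, (IsConvexSubgroup H ∧ H ≠ ⊤) ↔ H = ⊥

section

variable {K : Type*} [Field K] (A : ValuationSubring K)

/-- The valuation with valuation ring `A` is of rank `1`. The units of `A.ValueGroup` are the
value group, written multiplicatively with the order reversed. -/
def IsRankOneValuation : Prop := IsRankOneGroup (A.ValueGroup)ˣ

/-- `(K, A)` of residue characteristic `p` is tight: the value group has a smallest nonzero convex
subgroup, and it contains the value of `p`. -/
def IsTight (p : ℕ) : Prop :=
  ∃ Δ : Subgroup (A.ValueGroup)ˣ,
    IsLeast {H : Subgroup (A.ValueGroup)ˣ | IsConvexSubgroup H ∧ H ≠ ⊥} Δ ∧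
    ∃ γ ∈ Δ, (γ : A.ValueGroup) = A.valuation (p : K)

/-! ### Comparability, cofinality, prohenselianity

`A.valuation` is multiplicative: `v r ≤ v t` in additive notation is
`A.valuation t ≤ A.valuation r`, and `t` is in the maximal ideal iff `A.valuation t < 1`. -/

/-- Comparability of `r` and `t`: `v (r ^ n) ≤ v t ≤ v (r ^ (n + 1))` for some `n ≥ 1`, or the same
with `r` and `t` interchanged. -/
def Comparable (r t : K) : Prop :=
  ∃ n : ℕ, 1 ≤ n ∧
    ((A.valuation t ≤ A.valuation (r ^ n) ∧ A.valuation (r ^ (n + 1)) ≤ A.valuation t) ∨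
     (A.valuation r ≤ A.valuation (t ^ n) ∧ A.valuation (t ^ (n + 1)) ≤ A.valuation r))

/-- `r ≪ t`: incomparable and `v r < v t`. -/
def MuchLess (r t : K) : Prop := ¬ Comparable A r t ∧ A.valuation t < A.valuation r

/-- `t` is a cofinal element in `S`: the multiples of `v t` are cofinal in the set of the values of
the (nonzero) elements of `S`. -/
def IsCofinalElement (t : K) (S : Set K) : Prop :=
  t ∈ S ∧ ∀ r ∈ S, r ≠ 0 → ∃ n : ℕ, A.valuation (t ^ n) ≤ A.valuation r

/-- The relative algebraic closure in `K` of the subfield of `K` generated by `S`. -/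
def genAlgClosure (S : Set K) : Subfield K :=
  (algebraicClosure (Subfield.closure S) K).toSubfield

/-- The valuation ring `A` admits a henselian coarsening: a larger henselian valuation ring that is
still a proper subring of the field. -/
def AdmitsHenselianCoarsening : Prop :=
  ∃ B : ValuationSubring K, A ≤ B ∧ B ≠ ⊤ ∧ HenselianLocalRing B

/-- `(K, A)` is of prohenselian degree `n`. -/
def IsProhenselianOfDegree (n : ℕ) : Prop :=
  ∀ m : ℕ, 1 ≤ m → m ≤ n → ∀ t : Fin m → K, (∀ i, A.valuation (t i) < 1) →
    (∀ i j, i < j → MuchLess A (t i) (t j)) →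
    AdmitsHenselianCoarsening (A.comap (genAlgClosure (Set.range t)).subtype)

end

/-! ### Conservative subgroups -/

/-- The function symbols of the language of groups. -/
inductive GroupFunc : ℕ → Type
  | one : GroupFunc 0
  | inv : GroupFunc 1
  | mul : GroupFunc 2

/-- The language of groups. -/
def groupLang : Language := ⟨GroupFunc, fun _ => Empty⟩

/-- The interpretation of the function symbols in a group. -/
def groupFunMap {G : Type*} [Group G] : ∀ {n : ℕ}, GroupFunc n → (Fin n → G) → G
  | _, .one, _ => 1
  | _, .inv, x => (x 0)⁻¹
  | _, .mul, x => x 0 * x 1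

instance groupStructure (G : Type*) [Group G] : groupLang.Structure G where
  funMap := fun f x => groupFunMap f x
  RelMap := fun r _ => Empty.elim r

/-- The embedding of the nonzero rational numbers into the multiplicative group of `K`. -/
def ratUnits (K : Type*) [Field K] [CharZero K] : ℚˣ →* Kˣ :=
  Units.map (algebraMap ℚ K).toMonoidHom

/-- `C` is a conservative subgroup of the multiplicative group of `(K, A)`, where `p` is the
residue characteristic: it contains the nonzero rationals; `p` is a cofinal element in the relative
algebraic closure of `ℚ(r)` for all `r ∈ C`; and every existential formula of the language of groups
with parameters from the nonzero rationals that holds in `Kˣ` holds in `C`. -/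
structure IsConservative {K : Type*} [Field K] [CharZero K] (A : ValuationSubring K) (p : ℕ)
    (C : Subgroup Kˣ) : Prop where
  rat_mem : ∀ q : ℚˣ, ratUnits K q ∈ C
  cofinal : ∀ r ∈ C, IsCofinalElement A (p : K) (genAlgClosure {(r : K)})
  existentially_closed : ∀ (k : ℕ) (φ : groupLang.Formula (Fin k)),
    Language.BoundedFormula.IsExistential φ → ∀ q : Fin k → ℚˣ,
      φ.Realize (fun i => ratUnits K (q i)) →
        φ.Realize (fun i => (⟨ratUnits K (q i), rat_mem (q i)⟩ : C))

end

/-! A model is of rank 1 if it omits two types: that of a nonzero element divisible by every power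
of `p`, and that of a non-unit of the valuation ring none of whose positive powers is divisible by
`p`. By the omitting types theorem a model of the complete theory of `K` omitting both exists once
neither type is isolated. Tightness means that `K` itself omits the second.

For the first, suppose that a satisfiable formula `θ` forces divisibility by all powers of `p`. The
nonzero integral multiples of realizations of `θ` form a definable set of such elements, by QE
defined by a quantifier-free `ψ`. But such a `ψ` cannot separate suitable powers of these elements
from high powers of `p`: write a nonzero integer polynomial as `X ^ k * (a + X * g)` with `a ≠ 0`.
If `z` is small enough, prohenselianity makes `1 + (z / a) * g(z)` an `n`-th power, so the value at
`z` is `z ^ k * a` times an `n`-th power. When `z` is itself an `n`-th power, `P_n` only tests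
whether `a` is an `n`-th power, independently of `z`. Hence some power of `p` would be divisible by
all powers of `p`, which is absurd. This is `exists_eventually_realize_iff_of_isQF` together with
`exists_realize_notDivPowFormula`. -/

open Polynomial

/-! ### Roots of 1 + n²m in henselian rings -/

/-- With `n = N + 2`, one looks for an `n`-th root `1 + n * m / s` of `1 + n ^ 2 * m`. Expanding,
clearing `s ^ n` and cancelling `n ^ 2 * m` leaves `s ^ n - s ^ (n - 1) - m * g(s) = 0`, which is
monic and has the simple root `1` modulo `m`. The factor `n ^ 2` makes this work whether or not `n`
is a unit; putting `s` in the denominator makes the equation monic. -/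
theorem exists_isUnit_add_pow_eq {R : Type*} [CommRing R] [HenselianLocalRing R] {m : R}
    (hm : m ∈ IsLocalRing.maximalIdeal R) (N : ℕ) :
    ∃ s : R, IsUnit s ∧
      (s + (N + 2 : ℕ) * m) ^ (N + 2) = (1 + ((N + 2 : ℕ) : R) ^ 2 * m) * s ^ (N + 2) := by
  set c : R := ((N + 2 : ℕ) : R) with hc
  let g : R[X] := ∑ k ∈ Finset.range (N + 1),
    C (m ^ k * c ^ k * ((N + 2).choose (k + 2) : ℕ)) * X ^ (N - k)
  let f : R[X] := X ^ (N + 1 + 1) - (X ^ (N + 1) + C m * g)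
  have hg : g.degree ≤ (N + 1 : ℕ) := by
    refine (degree_sum_le _ _).trans (Finset.sup_le fun k _ => ?_)
    exact (degree_C_mul_X_pow_le _ _).trans (by exact_mod_cast (by omega : N - k ≤ N + 1))
  have hf : f.Monic := by
    refine monic_X_pow_sub (lt_of_le_of_lt ((degree_add_le _ _).trans
      (max_le (degree_X_pow_le _) ?_)) (Nat.cast_lt.2 (Nat.lt_succ_self (N + 1))))
    rw [← smul_eq_C_mul]
    exact (degree_smul_le _ _).trans hg
  have h0 : f.eval 1 ∈ IsLocalRing.maximalIdeal R := by
    have : f.eval 1 = m * -(g.eval 1) := by simp [f]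
    rw [this]
    exact Ideal.mul_mem_right _ _ hm
  have h1 : IsUnit (f.derivative.eval 1) := by
    have : f.derivative.eval 1 = 1 - m * g.derivative.eval 1 := by
      simp [f]
    rw [this]
    exact (IsLocalRing.isUnit_or_isUnit_one_sub_self _).resolve_left
      ((IsLocalRing.mem_maximalIdeal _).1 (Ideal.mul_mem_right _ _ hm))
  obtain ⟨s, hs, hs1⟩ := HenselianLocalRing.is_henselian f hf 1 h0 h1
  refine ⟨s, ?_, ?_⟩
  · by_contra hu
    have : (1 : R) ∈ IsLocalRing.maximalIdeal R := by
      simpa using Ideal.sub_mem _ ((IsLocalRing.mem_maximalIdeal _).2 hu) hs1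
    exact (IsLocalRing.mem_maximalIdeal _).1 this isUnit_one
  · have hs' : s ^ (N + 2) - (s ^ (N + 1) + m * g.eval s) = 0 := by
      simpa [f, IsRoot] using hs
    have hge : c ^ 2 * m ^ 2 * g.eval s = ∑ k ∈ Finset.range (N + 1),
        (c * m) ^ (k + 2) * s ^ (N + 2 - (k + 2)) * ((N + 2).choose (k + 2) : ℕ) := by
      simp only [g, eval_finsetSum, Finset.mul_sum]
      refine Finset.sum_congr rfl fun k _ => ?_
      simp only [eval_mul, eval_C, eval_pow, eval_X, Nat.reduceSubDiff]
      ring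
    -- The binomial terms of degree 0 and 1 in `m` are split off; the others add up to `c ^ 2 * m ^
    -- 2 * g(s)`.
    rw [add_comm s, add_pow, Finset.sum_range_succ', Finset.sum_range_succ', ← hge]
    simp only [zero_add, pow_zero, one_mul, Nat.choose_zero_right, Nat.choose_one_right, pow_one,
      Nat.sub_zero, Nat.cast_one, mul_one, ← hc, Nat.reduceSubDiff]
    linear_combination (-(c ^ 2 * m)) * hs'

/-! ### Extracting roots from prohenselianity -/

section

variable {K : Type*} [Field K]

/-- The localization of `A` away from `z`, as a valuation ring. -/
def ValuationSubring.awayFrom (A : ValuationSubring K) (z : K) (hz : z ∈ A) :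
    ValuationSubring K where
  carrier := {y | ∃ k : ℕ, z ^ k * y ∈ A}
  mul_mem' := by
    rintro a b ⟨k, hk⟩ ⟨l, hl⟩
    exact ⟨k + l, by convert A.mul_mem _ _ hk hl using 1; ring⟩
  one_mem' := ⟨0, by simp⟩
  add_mem' := by
    rintro a b ⟨k, hk⟩ ⟨l, hl⟩
    refine ⟨k + l, ?_⟩
    convert A.add_mem _ _ (A.mul_mem _ _ (pow_mem hz l) hk)
      (A.mul_mem _ _ (pow_mem hz k) hl) using 1
    ring
  zero_mem' := ⟨0, by simp⟩
  neg_mem' := by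
    rintro a ⟨k, hk⟩
    exact ⟨k, by simpa using A.neg_mem _ hk⟩
  mem_or_inv_mem' := fun a => (A.mem_or_inv_mem a).imp
    (fun h => ⟨0, by simpa using h⟩) (fun h => ⟨0, by simpa using h⟩)

theorem ValuationSubring.mem_awayFrom {A : ValuationSubring K} {z : K} {hz : z ∈ A} {y : K} :
    y ∈ A.awayFrom z hz ↔ ∃ k : ℕ, z ^ k * y ∈ A := Iff.rfl

/-- Valuation rings are integrally closed, and elements algebraic over a subfield are integral over
it. -/
theorem ValuationSubring.genAlgClosure_subset {B : ValuationSubring K} {S : Set K}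
    (h : ∀ x ∈ Subfield.closure S, x ∈ B) {x : K} (hx : x ∈ genAlgClosure S) : x ∈ B := by
  have hx' : IsIntegral (Subfield.closure S) x :=
    (mem_algebraicClosure_iff.1 hx : IsAlgebraic _ x).isIntegral
  have hx'' : IsIntegral B x := by
    obtain ⟨q, hq, hq0⟩ := hx'
    refine ⟨q.map (Subring.inclusion (show (Subfield.closure S).toSubring ≤ B.toSubring from h)),
      hq.map _, ?_⟩
    rw [eval₂_map]
    exact hq0
  obtain ⟨y, rfl⟩ := IsIntegrallyClosed.isIntegral_iff.1 hx''
  exact y.2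

/-- The condition `hc` places `ℚ(z)` inside the localization `A[1/z]`, which is a valuation ring and
so contains the relative algebraic closure too. -/
theorem exists_mul_mem_of_mem_genAlgClosure {A : ValuationSubring K} {z : K} (hz : z ∈ A)
    (hc : ∀ f : ℤ[X], aeval z f ≠ 0 → ∃ k : ℕ, z ^ k / aeval z f ∈ A) {r : K}
    (hr : r ∈ genAlgClosure {z}) : ∃ k : ℕ, z ^ k * r ∈ A := by
  refine ValuationSubring.mem_awayFrom (hz := hz) |>.1
    (ValuationSubring.genAlgClosure_subset (fun x hx => ?_) hr)
  have hpol : ∀ y ∈ Subring.closure {z}, ∃ f : ℤ[X], aeval z f = y := by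
    intro y hy
    have : y ∈ Algebra.adjoin ℤ {z} := by
      rw [Algebra.adjoin_int]; exact hy
    rwa [Algebra.adjoin_singleton_eq_range_aeval] at this
  obtain ⟨a, ha, b, hb, rfl⟩ := Subfield.mem_closure_iff.1 hx
  have hA : a ∈ A := (Subring.closure_le (t := A.toSubring)).2 (by simpa using hz) ha
  obtain ⟨f, rfl⟩ := hpol b hb
  by_cases h0 : aeval z f = 0
  · exact ⟨0, by simp [h0]⟩
  · obtain ⟨k, hk⟩ := hc f h0
    exact ⟨k, by convert A.mul_mem _ _ hk hA using 1; ring⟩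

theorem mem_genAlgClosure_self (z : K) : z ∈ genAlgClosure {z} :=
  mem_algebraicClosure_iff.2
    (isAlgebraic_algebraMap (⟨z, Subfield.subset_closure rfl⟩ : Subfield.closure {z}))

/-- Hensel's lemma is available only in a coarsening `B` that is not explicit. Since powers of `z`
clear all denominators, `z` is a non-unit in every proper coarsening, and then so is `m`. Asking for
`z ∣ m ^ 2` rather than `z ∣ m` leaves room for integer denominators in `m`. -/
theorem exists_pow_eq_one_add {A : ValuationSubring K} (hpro : IsProhenselianOfDegree A 1) {z : K}
    (hz : A.valuation z < 1) (hz0 : z ≠ 0)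
    (hc : ∀ f : ℤ[X], aeval z f ≠ 0 → ∃ k : ℕ, z ^ k / aeval z f ∈ A) {m : K}
    (hm : m ∈ genAlgClosure {z}) (hmz : m ^ 2 / z ∈ A) {n : ℕ} (hn : 1 < n) :
    ∃ t : K, t ≠ 0 ∧ t ^ n = 1 + (n : K) ^ 2 * m := by
  have hzA : z ∈ A := (A.valuation_le_one_iff z).1 hz.le
  have hpz := hpro 1 le_rfl le_rfl (fun _ => z) (fun _ => hz) (fun i j hij => by omega)
  rw [Set.range_const] at hpz
  obtain ⟨B, hAB, hB, _⟩ := hpz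
  let F := genAlgClosure {z}
  let zF : F := ⟨z, mem_genAlgClosure_self z⟩
  have hzF0 : zF ≠ 0 := fun h => hz0 (congrArg Subtype.val h)
  let mF : F := ⟨m, hm⟩
  obtain ⟨r, hr⟩ : ∃ r : F, r ∉ B := by
    by_contra! h
    exact hB (eq_top_iff.2 fun x _ => h x)
  obtain ⟨k, hk⟩ := exists_mul_mem_of_mem_genAlgClosure hzA hc r.2
  have hkB : zF ^ k * r ∈ B := hAB hk
  -- If `z` were a unit of `B`, then `z ^ k * r ∈ B` would give `r ∈ B`.
  have hzB : B.valuation zF < 1 := by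
    by_contra! h
    have hinv : zF⁻¹ ∈ B := by
      rw [← B.valuation_le_one_iff, map_inv₀]
      exact inv_le_one_of_one_le₀ h
    refine hr ?_
    have := B.mul_mem _ _ (pow_mem hinv k) hkB
    rwa [← mul_assoc, ← mul_pow, inv_mul_cancel₀ hzF0, one_pow, one_mul] at this
  have hm2 : mF ^ 2 / zF ∈ B := hAB hmz
  have hmB : B.valuation mF < 1 := by
    have h1 : B.valuation mF ^ 2 < 1 := by
      rw [← map_pow, ← div_mul_cancel₀ (mF ^ 2) hzF0, map_mul]
      exact mul_lt_one_of_nonneg_of_lt_one_right ((B.valuation_le_one_iff _).2 hm2) zero_le hzB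
    exact (pow_lt_one_iff_of_nonneg zero_le two_ne_zero).1 h1
  have hmB' : mF ∈ B := (B.valuation_le_one_iff _).1 hmB.le
  obtain ⟨N, rfl⟩ : ∃ N, n = N + 2 := ⟨n - 2, by omega⟩
  obtain ⟨s, hs, hs'⟩ := exists_isUnit_add_pow_eq (R := B) (m := ⟨mF, hmB'⟩)
    ((B.valuation_lt_one_iff _).2 hmB) N
  have hs0 : ((s : F) : K) ≠ 0 := by
    intro h
    exact hs.ne_zero (Subtype.ext (Subtype.ext h))
  have hs'' := congrArg (F.subtype.comp B.subtype) hs'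
  simp only [map_pow, map_add, map_mul, map_natCast, map_one] at hs''
  have h2 : (((s : F) : K) + ((N + 2 : ℕ) : K) * m) ^ (N + 2) =
      (1 + ((N + 2 : ℕ) : K) ^ 2 * m) * ((s : F) : K) ^ (N + 2) := by
    exact hs''
  have hpow : ((((s : F) : K) + ((N + 2 : ℕ) : K) * m) / ((s : F) : K)) ^ (N + 2) =
      1 + ((N + 2 : ℕ) : K) ^ 2 * m := by
    rw [div_pow, h2, mul_div_cancel_right₀ _ (pow_ne_zero _ hs0)]
  refine ⟨_, ?_, hpow⟩
  intro h0
  rw [h0, zero_pow (by omega)] at hpow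
  -- The root is nonzero because `1 + n ^ 2 * m` has value `1` for `A`.
  have hmA : A.valuation m < 1 := by
    have h1 : A.valuation m ^ 2 < 1 := by
      rw [← map_pow, ← div_mul_cancel₀ (m ^ 2) hz0, map_mul]
      exact mul_lt_one_of_nonneg_of_lt_one_right ((A.valuation_le_one_iff _).2 hmz) zero_le hz
    exact (pow_lt_one_iff_of_nonneg zero_le two_ne_zero).1 h1
  have h3 : A.valuation (((N + 2 : ℕ) : K) ^ 2 * m) < 1 := by
    rw [map_mul]
    refine mul_lt_one_of_nonneg_of_lt_one_right ((A.valuation_le_one_iff _).2 ?_) zero_le hmA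
    exact pow_mem (natCast_mem A _) 2
  have h4 := A.valuation.map_add_eq_of_lt_right (x := ((N + 2 : ℕ) : K) ^ 2 * m) (y := 1)
    (by simpa using h3)
  rw [add_comm, ← hpow] at h4
  simp at h4

/-- The lowest nonzero coefficient `a` is isolated because it governs the value at small arguments.
-/
theorem Polynomial.exists_eq_X_pow_mul {f : ℤ[X]} (hf : f ≠ 0) :
    ∃ (k : ℕ) (a : ℤ) (g : ℤ[X]), a ≠ 0 ∧ f = X ^ k * (C a + X * g) := by
  obtain ⟨q, hq, hd⟩ := exists_eq_pow_rootMultiplicity_mul_and_not_dvd f hf 0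
  refine ⟨f.rootMultiplicity 0, q.coeff 0, q.divX, ?_, ?_⟩
  · rw [C_0, sub_zero, X_dvd_iff] at hd
    exact hd
  · rw [add_comm, X_mul, divX_mul_X_add]
    simpa using hq

end

/-! ### Integer polynomials at elements infinitely divisible by p and at high powers of p -/

section

variable {K : Type*} [Field K] {A : ValuationSubring K} {p : ℕ}

theorem ValuationSubring.inv_intCast_mem_of_not_dvd
    (hchar : CharP (IsLocalRing.ResidueField A) p) {u : ℤ} (hu : ¬ (p : ℤ) ∣ u) :
    (u : K)⁻¹ ∈ A := by
  have h1 : IsUnit (u : A) := by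
    rw [← IsLocalRing.residue_ne_zero_iff_isUnit, map_intCast, Ne,
      CharP.intCast_eq_zero_iff (IsLocalRing.ResidueField A) p]
    exact hu
  obtain ⟨w, hw⟩ := h1.exists_right_inv
  have hw' : (u : K) * (w : K) = 1 := by
    have := congrArg A.subtype hw
    simpa using this
  rw [inv_eq_of_mul_eq_one_right hw']
  exact w.2

theorem ValuationSubring.exists_pow_div_intCast_mem
    (hchar : CharP (IsLocalRing.ResidueField A) p) [CharZero K] (hp : 0 < p)
    {a : ℤ} (ha : a ≠ 0) : ∃ k : ℕ, (p : K) ^ k / a ∈ A := by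
  have hp1 : p ≠ 1 := CharP.char_ne_one (IsLocalRing.ResidueField A) p
  have hfin : FiniteMultiplicity (p : ℤ) a :=
    Int.finiteMultiplicity_iff.2 ⟨by simpa using hp1, ha⟩
  obtain ⟨u, hau, hu⟩ := hfin.exists_eq_pow_mul_and_not_dvd
  refine ⟨multiplicity (p : ℤ) a, ?_⟩
  have hpK : (p : K) ≠ 0 := Nat.cast_ne_zero.2 hp.ne'
  have : (p : K) ^ multiplicity (p : ℤ) a / a = (u : K)⁻¹ := by
    conv_lhs => rw [hau]
    push_cast
    rw [← div_div]
    have : (p : K) ^ multiplicity (p : ℤ) a ≠ 0 := pow_ne_zero _ hpK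
    rw [← hau] at *
    field_simp
  rw [this]
  exact inv_intCast_mem_of_not_dvd hchar hu

theorem ValuationSubring.valuation_natCast_lt_one
    (hchar : CharP (IsLocalRing.ResidueField A) p) : A.valuation (p : K) < 1 := by
  have : (p : A) ∈ IsLocalRing.maximalIdeal A := by
    rw [← IsLocalRing.residue_eq_zero_iff, map_natCast]
    exact CharP.cast_eq_zero _ p
  simpa using (A.valuation_lt_one_iff (p : A)).1 this

theorem ValuationSubring.aeval_mem {z : K} (hz : z ∈ A) (f : ℤ[X]) : aeval z f ∈ A := by
  rw [aeval_eq_sum_range]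
  exact sum_mem fun i _ => zsmul_mem (pow_mem hz i) _

/-- One has `a + z * g(z) = a * (1 + n ^ 2 * m)` with `m = z / (a * n ^ 2) * g(z)`. The base `t` is
kept apart from `z` so that `z` can be a power of `t = p`. -/
theorem exists_aeval_eq_mul_pow [CharZero K] (hpro : IsProhenselianOfDegree A 1) {t z : K}
    (ht : A.valuation t < 1) (ht0 : t ≠ 0)
    (hc : ∀ f : ℤ[X], aeval t f ≠ 0 → ∃ k : ℕ, t ^ k / aeval t f ∈ A)
    (hzt : z ∈ genAlgClosure {t}) (hz : z ∈ A) {k : ℕ} {a : ℤ} (ha : a ≠ 0) (g : ℤ[X]) {n : ℕ}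
    (hn : 1 < n) (h : (z / (a * (n : K) ^ 2)) ^ 2 / t ∈ A) :
    ∃ s : K, s ≠ 0 ∧ aeval z (X ^ k * (C a + X * g)) = z ^ k * a * s ^ n := by
  have ha' : (a : K) ≠ 0 := Int.cast_ne_zero.2 ha
  have hn' : (n : K) ≠ 0 := Nat.cast_ne_zero.2 (by omega)
  have hm : z / (a * (n : K) ^ 2) * aeval z g ∈ genAlgClosure {t} := by
    refine mul_mem (div_mem hzt (mul_mem (intCast_mem _ a) (pow_mem (natCast_mem _ n) 2))) ?_
    rw [aeval_eq_sum_range]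
    exact sum_mem fun i _ => zsmul_mem (pow_mem hzt i) _
  have hmt : (z / (a * (n : K) ^ 2) * aeval z g) ^ 2 / t ∈ A := by
    convert A.mul_mem _ _ h (pow_mem (A.aeval_mem hz g) 2) using 1
    ring
  obtain ⟨s, hs0, hs⟩ := exists_pow_eq_one_add hpro ht ht0 hc hm hmt hn
  refine ⟨s, hs0, ?_⟩
  rw [hs]
  simp only [map_mul, map_pow, aeval_X, map_add, eq_intCast, map_intCast]
  field_simp

/-- `z` is a nonzero element of `A` that is divisible by all powers of `t`. -/
def ValuationSubring.Dominates (A : ValuationSubring K) (t z : K) : Prop :=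
  z ≠ 0 ∧ ∀ n : ℕ, z / t ^ n ∈ A

namespace ValuationSubring.Dominates

theorem mem {t z : K} (h : A.Dominates t z) : z ∈ A := by simpa using h.2 0

theorem mul {t z y : K} (h : A.Dominates t z) (hy : y ∈ A) (hy0 : y ≠ 0) :
    A.Dominates t (z * y) :=
  ⟨mul_ne_zero h.1 hy0, fun n => by
    convert A.mul_mem _ _ (h.2 n) hy using 1; ring⟩

theorem pow {t z : K} (h : A.Dominates t z) {n : ℕ} (hn : 0 < n) : A.Dominates t (z ^ n) := by
  obtain ⟨m, rfl⟩ := Nat.exists_eq_succ_of_ne_zero hn.ne'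
  rw [pow_succ']
  exact h.mul (pow_mem h.mem m) (pow_ne_zero _ h.1)

theorem valuation_lt_one {t z : K} (h : A.Dominates t z) (ht : A.valuation t < 1)
    (ht0 : t ≠ 0) : A.valuation z < 1 := by
  rw [← div_mul_cancel₀ z ht0, map_mul]
  exact mul_lt_one_of_nonneg_of_lt_one_right
    ((A.valuation_le_one_iff _).2 (by simpa using h.2 1)) zero_le ht

variable [CharZero K]

theorem div_intCast (hchar : CharP (IsLocalRing.ResidueField A) p) (hp : 0 < p)
    {z : K} (h : A.Dominates (p : K) z) {a : ℤ} (ha : a ≠ 0) : A.Dominates (p : K) (z / a) := by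
  have hpK : (p : K) ≠ 0 := Nat.cast_ne_zero.2 hp.ne'
  refine ⟨div_ne_zero h.1 (Int.cast_ne_zero.2 ha), fun n => ?_⟩
  obtain ⟨k, hk⟩ := exists_pow_div_intCast_mem (K := K) hchar hp ha
  convert A.mul_mem _ _ (h.2 (n + k)) hk using 1
  field_simp
  ring

/-- In the factorization `z ^ k * a * (1 + (z / a) * g(z))` the last factor is a unit of `A`, and
one further power of `z` absorbs `a`. -/
theorem exists_pow_div_aeval_mem (hchar : CharP (IsLocalRing.ResidueField A) p) (hp : 0 < p)
    {z : K} (h : A.Dominates (p : K) z) (f : ℤ[X]) (hf : aeval z f ≠ 0) :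
    ∃ k : ℕ, z ^ k / aeval z f ∈ A := by
  have hpK : (p : K) ≠ 0 := Nat.cast_ne_zero.2 hp.ne'
  obtain ⟨k, a, g, ha, rfl⟩ := exists_eq_X_pow_mul (f := f) (by rintro rfl; simp at hf)
  have ha' : (a : K) ≠ 0 := Int.cast_ne_zero.2 ha
  have hd := h.div_intCast hchar hp ha
  have hlt : A.valuation (z / a * aeval z g) < 1 := by
    rw [map_mul]
    exact mul_lt_one_of_lt_of_le (hd.valuation_lt_one (valuation_natCast_lt_one hchar) hpK)
      ((A.valuation_le_one_iff _).2 (A.aeval_mem h.mem g))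
  have h1 : A.valuation (1 + z / a * aeval z g) = 1 := by
    rw [A.valuation.map_add_eq_of_lt_left (by simpa using hlt), map_one]
  have h2 : (1 + z / a * aeval z g)⁻¹ ∈ A := by
    rw [← A.valuation_le_one_iff, map_inv₀, h1, inv_one]
  refine ⟨k + 1, ?_⟩
  convert A.mul_mem _ _ hd.mem h2 using 1
  have h3 : 1 + z / a * aeval z g ≠ 0 := by
    intro h0
    rw [h0, map_zero] at h1
    exact zero_ne_one h1
  have hz := h.1
  have h4 : (a : K) + z * aeval z g = a * (1 + z / a * aeval z g) := by field_simp
  simp only [map_mul, map_pow, aeval_X, map_add, eq_intCast, map_intCast]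
  rw [h4]
  field_simp
  ring

theorem exists_aeval_eq_mul_pow (hpro : IsProhenselianOfDegree A 1)
    (hchar : CharP (IsLocalRing.ResidueField A) p) (hp : 0 < p)
    {z : K} (h : A.Dominates (p : K) z) {k : ℕ} {a : ℤ} (ha : a ≠ 0) (g : ℤ[X]) {n : ℕ}
    (hn : 1 < n) :
    ∃ s : K, s ≠ 0 ∧ aeval z (X ^ k * (C a + X * g)) = z ^ k * a * s ^ n := by
  have hpK : (p : K) ≠ 0 := Nat.cast_ne_zero.2 hp.ne'
  refine _root_.exists_aeval_eq_mul_pow hpro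
    (h.valuation_lt_one (valuation_natCast_lt_one hchar) hpK) h.1
    (h.exists_pow_div_aeval_mem hchar hp) (mem_genAlgClosure_self z) h.mem ha g hn ?_
  -- The integer comes from `(z / (a * n ^ 2)) ^ 2 / z = z / (a * n ^ 2) ^ 2`.
  have h1 := (h.div_intCast hchar hp (a := (a * n ^ 2) ^ 2)
    (pow_ne_zero _ (mul_ne_zero ha (pow_ne_zero _ (by omega))))).mem
  convert h1 using 1
  have hz := h.1
  push_cast
  field_simp

end ValuationSubring.Dominates

theorem exists_aeval_natCast_pow_eq_mul_pow [CharZero K] (hpro : IsProhenselianOfDegree A 1)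
    (hchar : CharP (IsLocalRing.ResidueField A) p) (hp : 0 < p)
    (k : ℕ) {a : ℤ} (ha : a ≠ 0) (g : ℤ[X]) {n : ℕ} (hn : 1 < n) :
    ∃ j₀ : ℕ, ∀ j ≥ j₀, ∃ s : K, s ≠ 0 ∧
      aeval ((p : K) ^ j) (X ^ k * (C a + X * g)) = ((p : K) ^ j) ^ k * a * s ^ n := by
  have hpK : (p : K) ≠ 0 := Nat.cast_ne_zero.2 hp.ne'
  have hpA : (p : K) ∈ A := natCast_mem A p
  obtain ⟨l, hl⟩ := ValuationSubring.exists_pow_div_intCast_mem (K := K) hchar hp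
    (a := a * n ^ 2) (mul_ne_zero ha (pow_ne_zero _ (by omega)))
  -- The exponent `l` absorbs `a * n ^ 2`; the extra `1` leaves a factor `p` after squaring, to be
  -- divided by the base `t = p`.
  refine ⟨l + 1, fun j hj => ?_⟩
  obtain ⟨i, rfl⟩ := Nat.exists_eq_add_of_le hj
  refine exists_aeval_eq_mul_pow hpro (ValuationSubring.valuation_natCast_lt_one hchar) hpK ?_
    (pow_mem (natCast_mem _ p) _) (pow_mem hpA _) ha g hn ?_
  · intro f hf
    have hf' : aeval (p : K) f = ((f.eval (p : ℤ) : ℤ) : K) := by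
      have := aeval_algebraMap_apply_eq_algebraMap_eval (A := K) (p : ℤ) f
      simpa using this
    rw [hf'] at hf ⊢
    exact ValuationSubring.exists_pow_div_intCast_mem hchar hp (Int.cast_ne_zero.1 hf)
  · convert A.mul_mem _ _ (pow_mem hl 2) (pow_mem hpA (2 * i + 1)) using 1
    push_cast
    field_simp
    ring

end

/-! ### Quantifier-free formulas cannot separate the two kinds of elements -/

section

variable {K : Type*} [Field K] {A : ValuationSubring K} {p : ℕ}

theorem exists_aeval_eq_realize (A : ValuationSubring K) {α : Type*} (t : macLang.Term α) :
    letI := macStructure A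
    ∃ f : ℤ[X], ∀ x : K, t.realize (fun _ => x) = aeval x f := by
  let _ := macStructure A
  induction t with
  | var _ => exact ⟨X, fun x => (aeval_X x).symm⟩
  | func f ts ih =>
    choose g hg using ih
    cases f with
    | add =>
      refine ⟨g 0 + g 1, fun x => ?_⟩
      rw [map_add, ← hg 0 x, ← hg 1 x]; rfl
    | mul =>
      refine ⟨g 0 * g 1, fun x => ?_⟩
      rw [map_mul, ← hg 0 x, ← hg 1 x]; rfl
    | neg =>
      refine ⟨-g 0, fun x => ?_⟩
      rw [map_neg, ← hg 0 x]; rfl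
    | zero => exact ⟨0, fun x => by rw [map_zero]; rfl⟩
    | one => exact ⟨1, fun x => by rw [map_one]; rfl⟩

variable [CharZero K]

/-- The truth value of a quantifier-free formula is the same for the `M`-th powers of all elements
divisible by all powers of `p` and for the large powers of `p ^ M`. -/
theorem exists_eventually_realize_iff_of_isQF (hpro : IsProhenselianOfDegree A 1)
    (hchar : CharP (IsLocalRing.ResidueField A) p) (hp : 0 < p)
    {α : Type*} {ψ : macLang.BoundedFormula α 0} (hψ : ψ.IsQF) :
    letI := macStructure A
    ∃ (M : ℕ) (b : Prop), 0 < M ∧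
      (∀ x : K, A.Dominates p x → (ψ.Realize (fun _ => x ^ M) default ↔ b)) ∧
      ∃ j₀ : ℕ, ∀ j ≥ j₀, (ψ.Realize (fun _ => (p : K) ^ (M * j)) default ↔ b) := by
  let _ := macStructure A
  have hpK : (p : K) ≠ 0 := Nat.cast_ne_zero.2 hp.ne'
  have helim : ∀ x : K, (Sum.elim (fun _ => x) default : α ⊕ Fin 0 → K) = fun _ => x := by
    intro x
    ext (i | i)
    · rfl
    · exact i.elim0
  induction hψ with
  | falsum => exact ⟨1, False, one_pos, fun _ _ => Iff.rfl, 0, fun _ _ => Iff.rfl⟩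
  | imp h₁ h₂ ih₁ ih₂ =>
    obtain ⟨M, b, hM, hx, j, hj⟩ := ih₁
    obtain ⟨N, c, hN, hy, l, hl⟩ := ih₂
    -- Both kinds of argument are stable under further powers, so the two exponents can be
    -- multiplied.
    refine ⟨M * N, b → c, Nat.mul_pos hM hN, fun x h => ?_, j + l, fun i hi => ?_⟩
    · refine imp_congr ?_ ?_
      · rw [mul_comm, pow_mul]
        exact hx _ (h.pow hN)
      · rw [pow_mul]
        exact hy _ (h.pow hM)
    · refine imp_congr ?_ ?_
      · rw [mul_assoc]
        refine hj _ ?_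
        nlinarith
      · rw [mul_comm M, mul_assoc]
        refine hl _ ?_
        nlinarith
  | of_isAtomic h =>
    cases h with
    | equal t₁ t₂ =>
      obtain ⟨f, hf⟩ := exists_aeval_eq_realize A t₁
      obtain ⟨g, hg⟩ := exists_aeval_eq_realize A t₂
      simp only [Language.BoundedFormula.realize_bdEqual, helim, hf, hg]
      by_cases hfg : f - g = 0
      · rw [sub_eq_zero.1 hfg]
        exact ⟨1, True, one_pos, fun _ _ => by simp, 0, fun _ _ => by simp⟩
      · obtain ⟨k, a, q, ha, hq⟩ := exists_eq_X_pow_mul hfg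
        have ha' : (a : K) ≠ 0 := Int.cast_ne_zero.2 ha
        simp only [← sub_eq_zero (b := aeval _ g), ← map_sub, hq]
        -- The exponent 2 is arbitrary: only the nonvanishing of the value matters.
        obtain ⟨j, hj⟩ := exists_aeval_natCast_pow_eq_mul_pow hpro hchar hp k ha q one_lt_two
        refine ⟨1, False, one_pos, fun x hx => ?_, j, fun i hi => ?_⟩
        · obtain ⟨s, hs, he⟩ := (hx.pow one_pos).exists_aeval_eq_mul_pow hpro hchar hp
            (k := k) ha q one_lt_two
          rw [he, iff_false]
          have := hx.1
          positivity
        · obtain ⟨s, hs, he⟩ := hj (1 * i) (by omega)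
          rw [he, iff_false]
          positivity
    | rel R ts =>
      simp only [Language.BoundedFormula.realize_rel, helim]
      cases R with
      | valRing =>
        obtain ⟨f, hf⟩ := exists_aeval_eq_realize A (ts 0)
        have hmem : ∀ z : K, z ∈ A → (macRelMap A .valRing (fun i => (ts i).realize fun _ => z) ↔
            True) := by
          intro z hz
          rw [iff_true]
          change (ts 0).realize (fun _ => z) ∈ A
          rw [hf]
          exact A.aeval_mem hz f
        exact ⟨1, True, one_pos, fun x hx => hmem _ (pow_mem hx.mem _), 0,
          fun j _ => hmem _ (pow_mem (natCast_mem A p) _)⟩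
      | pow n hn =>
        obtain ⟨f, hf⟩ := exists_aeval_eq_realize A (ts 0)
        have hrel : ∀ z : K, macRelMap A (.pow n hn) (fun i => (ts i).realize fun _ => z) ↔
            (aeval z f ≠ 0 ∧ ∃ y : K, y ^ n = aeval z f) := by
          intro z
          rw [← hf]
          exact Iff.rfl
        by_cases hf0 : f = 0
        · refine ⟨1, False, one_pos, fun x _ => (hrel _).trans ?_, 0,
            fun j _ => (hrel _).trans ?_⟩ <;> simp [hf0]
        obtain ⟨k, a, q, ha, rfl⟩ := exists_eq_X_pow_mul hf0
        have ha' : (a : K) ≠ 0 := Int.cast_ne_zero.2 ha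
        -- At an `n`-th power the factor `z ^ k` is an `n`-th power as well, so only the class of
        -- `a` remains.
        have key : ∀ x : K, x ≠ 0 → (∃ s : K, s ≠ 0 ∧
            aeval (x ^ n) (X ^ k * (C a + X * q)) = (x ^ n) ^ k * a * s ^ n) →
            (macRelMap A (.pow n hn) (fun i => (ts i).realize fun _ => x ^ n) ↔
              ∃ y : K, y ^ n = a) := by
          rintro x hx ⟨s, hs, he⟩
          rw [hrel, he]
          have hxs : x ^ k * s ≠ 0 := mul_ne_zero (pow_ne_zero _ hx) hs
          have heq : (x ^ n) ^ k * a * s ^ n = a * (x ^ k * s) ^ n := by ring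
          rw [heq]
          constructor
          · rintro ⟨-, y, hy⟩
            refine ⟨y / (x ^ k * s), ?_⟩
            rw [div_pow, hy, mul_div_cancel_right₀ _ (pow_ne_zero _ hxs)]
          · rintro ⟨y, hy⟩
            exact ⟨mul_ne_zero ha' (pow_ne_zero _ hxs), y * (x ^ k * s), by rw [mul_pow, hy]⟩
        obtain ⟨j, hj⟩ := exists_aeval_natCast_pow_eq_mul_pow hpro hchar hp k ha q hn
        refine ⟨n, ∃ y : K, y ^ n = a, by omega, fun x hx => key x hx.1 ?_, j, fun i hi => ?_⟩
        · exact (hx.pow (by omega)).exists_aeval_eq_mul_pow hpro hchar hp ha q hn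
        · have := hj (i * n) (by nlinarith)
          rw [pow_mul] at this
          have h2 := key _ (pow_ne_zero i hpK) this
          rw [mul_comm, pow_mul]
          exact h2

end

/-! ### The omitting types theorem -/

namespace FirstOrder.Language

section OmittingTypes

variable {L : Language.{0, 0}} {M : Type u} [L.Structure M]

theorem Formula.exists_realize_iff_exists_extend [Nonempty M] (φ : L.Formula ℕ) (k : ℕ) :
    ∃ θ : L.Formula (Fin 1), ∀ x : Fin 1 → M,
      θ.Realize x ↔ ∃ v : ℕ → M, v k = x 0 ∧ φ.Realize v := by
  classical
  let s : Finset ℕ := insert k φ.freeVarFinset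
  have hs : (φ.freeVarFinset : Set ℕ) ⊆ s := by
    simp [s]
  let φ' : L.Formula s := BoundedFormula.restrictFreeVar φ (Set.inclusion hs)
  have hφ' : ∀ v : ℕ → M, φ'.Realize (fun i : s => v i) ↔ φ.Realize v := fun v =>
    BoundedFormula.realize_restrictFreeVar' hs
  let k' : s := ⟨k, Finset.mem_insert_self _ _⟩
  refine ⟨Formula.iExs s (Formula.relabel Sum.inr φ' ⊓
    Term.equal (Term.var (Sum.inr k')) (Term.var (Sum.inl 0))), fun x => ?_⟩
  simp only [Formula.realize_iExs, Formula.realize_inf, Formula.realize_relabel,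
    Formula.realize_equal, Term.realize_var, Sum.elim_inl, Sum.elim_inr, Sum.elim_comp_inr]
  constructor
  · rintro ⟨i, hi, hk⟩
    let v : ℕ → M := fun n => if h : n ∈ s then i ⟨n, h⟩ else Classical.arbitrary M
    have hv : (fun j : s => v j) = i := by
      ext j
      simp [v]
    refine ⟨v, ?_, (hφ' v).1 (hv ▸ hi)⟩
    rw [← hk, ← hv]
  · rintro ⟨v, hv, hφ⟩
    exact ⟨fun j => v j, (hφ' v).2 hφ, hv⟩

variable (L M) in
/-- The formulas in countably many variables that are satisfiable in `M`, ordered by strength. -/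
def RealizedFormula : Type := {φ : L.Formula ℕ // ∃ v : ℕ → M, φ.Realize v}

/-- Stronger formulas are larger, so cofinal sets serve as the dense sets of a Henkin construction.
-/
instance : Preorder (RealizedFormula L M) where
  le φ ψ := ∀ v : ℕ → M, ψ.1.Realize v → φ.1.Realize v
  le_refl _ _ h := h
  le_trans _ _ _ h₁ h₂ v h := h₁ v (h₂ v h)

/-- The formula saying that the variable `j` is a witness for the last free variable of `φ` if
there is one. -/
def BoundedFormula.witnessFormula {n : ℕ} (φ : L.BoundedFormula Empty (n + 1)) (x : Fin n → ℕ)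
    (j : ℕ) : L.Formula ℕ :=
  (φ.ex.toFormula.relabel (Sum.elim Empty.elim x)).imp
    (φ.toFormula.relabel (Sum.elim Empty.elim (Fin.snoc x j : Fin (n + 1) → ℕ)))

theorem BoundedFormula.realize_witnessFormula {N : Type*} [L.Structure N] {n : ℕ}
    (φ : L.BoundedFormula Empty (n + 1)) (x : Fin n → ℕ) (j : ℕ) (v : ℕ → N) :
    (φ.witnessFormula x j).Realize v ↔ ((∃ a : N, φ.Realize default (Fin.snoc (v ∘ x) a)) →
      φ.Realize default (Fin.snoc (v ∘ x) (v j))) := by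
  simp only [witnessFormula, Formula.realize_imp, Formula.realize_relabel, realize_toFormula,
    realize_ex, Function.comp_assoc, Sum.elim_comp_inr, Fin.comp_snoc]
  have h : v ∘ Sum.elim Empty.elim x ∘ Sum.inl = default := Subsingleton.elim _ _
  have h' : v ∘ Sum.elim Empty.elim (Fin.snoc x j : Fin (n + 1) → ℕ) ∘ Sum.inl = default :=
    Subsingleton.elim _ _
  rw [h, h']

/-- A variable `j` that occurs neither in `q` nor in `x` can be reassigned to a witness without
disturbing `q`. -/
theorem isCofinal_witness {n : ℕ} (φ : L.BoundedFormula Empty (n + 1)) (x : Fin n → ℕ) :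
    IsCofinal {q : RealizedFormula L M | ∃ j, ∀ v : ℕ → M, q.1.Realize v →
      (φ.witnessFormula x j).Realize v} := by
  classical
  rintro ⟨q, v, hv⟩
  obtain ⟨j, hj⟩ := Infinite.exists_notMem_finset (q.freeVarFinset ∪ Finset.univ.image x)
  simp only [Finset.mem_union, Finset.mem_image, Finset.mem_univ, true_and, not_or,
    not_exists] at hj
  have hq : ∀ a : M, q.Realize (Function.update v j a) := by
    intro a
    have hs : (q.freeVarFinset : Set ℕ) ⊆ q.freeVarFinset := subset_rfl
    have h₁ := (BoundedFormula.realize_restrictFreeVar' hs (v := v) (xs := default)).2 hv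
    refine (BoundedFormula.realize_restrictFreeVar' hs).1 ?_
    convert! h₁ using 1
    ext i
    exact Function.update_of_ne (fun h : (i : ℕ) = j => hj.1 (by rw [← h]; exact i.2)) _ _
  have hx : ∀ a : M, Function.update v j a ∘ x = v ∘ x := fun a =>
    funext fun i => Function.update_of_ne (hj.2 i) _ _
  refine ⟨⟨q ⊓ φ.witnessFormula x j, ?_⟩, ⟨j, fun w hw => (Formula.realize_inf.1 hw).2⟩,
    fun w hw => (Formula.realize_inf.1 hw).1⟩
  by_cases ha : ∃ a : M, φ.Realize default (Fin.snoc (v ∘ x) a)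
  · obtain ⟨a, ha⟩ := ha
    refine ⟨Function.update v j a, Formula.realize_inf.2 ⟨hq a, ?_⟩⟩
    rw [BoundedFormula.realize_witnessFormula, hx, Function.update_self]
    exact fun _ => ha
  · exact ⟨v, Formula.realize_inf.2
      ⟨hv, (φ.realize_witnessFormula x j v).2 fun h => (ha h).elim⟩⟩

/-- What `q` says about the variable `k` alone is a satisfiable formula in one variable, hence
consistent with some `Φ n`. -/
theorem isCofinal_omit [Nonempty M] {Φ : ℕ → L.Formula (Fin 1)}
    (hΦ : ∀ θ : L.Formula (Fin 1), (∃ x : Fin 1 → M, θ.Realize x) →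
      ∃ (n : ℕ) (x : Fin 1 → M), θ.Realize x ∧ (Φ n).Realize x) (k : ℕ) :
    IsCofinal {q : RealizedFormula L M | ∃ n, ∀ v : ℕ → M, q.1.Realize v →
      ((Φ n).relabel (fun _ => k)).Realize v} := by
  rintro ⟨q, v, hv⟩
  obtain ⟨θ, hθ⟩ := q.exists_realize_iff_exists_extend (M := M) k
  obtain ⟨n, x, hx, hn⟩ := hΦ θ ⟨fun _ => v k, (hθ _).2 ⟨v, rfl, hv⟩⟩
  obtain ⟨w, hw, hqw⟩ := (hθ x).1 hx
  refine ⟨⟨q ⊓ (Φ n).relabel (fun _ => k), w, Formula.realize_inf.2 ⟨hqw, ?_⟩⟩,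
    ⟨n, fun w hw => (Formula.realize_inf.1 hw).2⟩, fun w hw => (Formula.realize_inf.1 hw).1⟩
  rw [Formula.realize_relabel]
  convert hn using 1
  ext i
  rw [Subsingleton.elim i 0]
  exact hw

/-- The **omitting types theorem** for the complete theory of `M` and countably many types in one
variable. The type `i` consists of the negations of the formulas `Φ i n`. -/
theorem exists_elementarilyEquivalent_omitting [Countable L.Symbols] [Nonempty M] {ι : Type}
    [Countable ι] (Φ : ι → ℕ → L.Formula (Fin 1))
    (hΦ : ∀ i, ∀ θ : L.Formula (Fin 1), (∃ x : Fin 1 → M, θ.Realize x) →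
      ∃ (n : ℕ) (x : Fin 1 → M), θ.Realize x ∧ (Φ i n).Realize x) :
    ∃ (N : Type u) (_ : L.Structure N), L.ElementarilyEquivalent N M ∧
      ∀ i, ∀ x : Fin 1 → N, ∃ n, (Φ i n).Realize x := by
  have hcount : ∀ n, Countable (L.BoundedFormula Empty n) := fun n =>
    (sigma_mk_injective (β := fun n => L.BoundedFormula Empty n) (i := n)).countable
  let ι' : Type := (Σ n, L.BoundedFormula Empty (n + 1) × (Fin n → ℕ)) ⊕ (ι × ℕ)
  let _ : Encodable ι' := Encodable.ofCountable _
  let D : ι' → Order.Cofinal (RealizedFormula L M) :=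
    Sum.elim (fun r => ⟨_, isCofinal_witness r.2.1 r.2.2⟩)
      (fun r => ⟨_, isCofinal_omit (hΦ r.1) r.2⟩)
  let q₀ : RealizedFormula L M := ⟨⊤, fun _ => Classical.arbitrary M, BoundedFormula.realize_top.2 trivial⟩
  let q := Order.sequenceOfCofinals q₀ D
  choose v hv using fun n => (q n).2
  -- The formulas of the generic sequence get stronger, so the sequence of their realizations in `M`
  -- defines a point of the ultrapower satisfying all of them.
  let u := Filter.hyperfilter ℕ
  let N : Type u := (u : Filter ℕ).Product fun _ => M
  let a : ℕ → N := fun i => ((fun n => v n i : ∀ _ : ℕ, M) : N)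
  have ha : ∀ (χ : L.Formula ℕ) (n : ℕ), (∀ w : ℕ → M, (q n).1.Realize w → χ.Realize w) →
      χ.Realize a := by
    intro χ n h
    refine (Ultraproduct.realize_formula_cast χ fun i n => v n i).2 ?_
    refine Filter.Eventually.filter_mono Nat.hyperfilter_le_atTop
      ((Filter.eventually_ge_atTop n).mono fun m hm => h _ ?_)
    exact Order.sequenceOfCofinals.monotone q₀ D hm _ (hv m)
  have hwit : ∀ (n : ℕ) (φ : L.BoundedFormula Empty (n + 1)) (x : Fin n → ℕ),
      (∃ b : N, φ.Realize default (Fin.snoc (a ∘ x) b)) →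
        ∃ j, φ.Realize default (Fin.snoc (a ∘ x) (a j)) := by
    intro n φ x h
    obtain ⟨j, hj⟩ := Order.sequenceOfCofinals.encode_mem q₀ D (Sum.inl ⟨n, φ, x⟩)
    exact ⟨j, (φ.realize_witnessFormula x j a).1 (ha _ _ hj) h⟩
  -- The coordinates of the generic point form an elementary substructure by Tarski–Vaught; closure
  -- under functions is the case of the formula `f(x) = y`.
  let S : L.Substructure N :=
    { carrier := Set.range a
      fun_mem := by
        intro n f x hx
        choose y hy using hx
        obtain rfl : a ∘ y = x := funext hy
        let φ : L.BoundedFormula Empty (n + 1) :=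
          (Term.func f fun i => Term.var (Sum.inr i.castSucc)).bdEqual
            (Term.var (Sum.inr (Fin.last n)))
        have hφ : ∀ b : N, φ.Realize default (Fin.snoc (a ∘ y) b) ↔
            Structure.funMap f (a ∘ y) = b := by
          intro b
          simp [φ, BoundedFormula.realize_bdEqual, Term.realize, Function.comp_def]
        obtain ⟨j, hj⟩ := hwit n φ y ⟨_, (hφ _).2 rfl⟩
        exact ⟨j, ((hφ _).1 hj).symm⟩ }
  have hS : S.IsElementary := by
    refine S.isElementary_of_exists fun n φ x b hb => ?_
    choose y hy using fun i => (x i).2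
    obtain h : a ∘ y = Subtype.val ∘ x := funext hy
    rw [← h] at hb ⊢
    obtain ⟨j, hj⟩ := hwit n φ y ⟨b, hb⟩
    exact ⟨⟨a j, j, rfl⟩, hj⟩
  let E : L.ElementarySubstructure N := ⟨S, hS⟩
  refine ⟨E, inferInstance, ?_, fun i x => ?_⟩
  · refine E.elementarilyEquivalent.trans ?_
    rw [elementarilyEquivalent_iff]
    intro φ
    exact (Ultraproduct.sentence_realize φ).trans Filter.eventually_const
  · obtain ⟨k, hk⟩ := (x 0).2
    obtain ⟨n, hn⟩ := Order.sequenceOfCofinals.encode_mem q₀ D (Sum.inr (i, k))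
    refine ⟨n, ?_⟩
    have := ha _ _ hn
    rw [Formula.realize_relabel] at this
    rw [← E.subtype.map_formula]
    convert this using 1
    ext l
    rw [Subsingleton.elim l 0]
    exact hk.symm

end OmittingTypes

end FirstOrder.Language

/-! ### Convex subgroups, tightness and rank one -/

/-- The subgroup of the elements between a power of `g` and its inverse; for `g ≤ 1` it is the
convex subgroup generated by `g`. -/
def convexClosure {G : Type*} [CommGroup G] [LinearOrder G] [IsOrderedMonoid G] (g : G) :
    Subgroup G where
  carrier := {h | ∃ n : ℕ, g ^ n ≤ h ∧ h ≤ (g ^ n)⁻¹}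
  one_mem' := ⟨0, by simp, by simp⟩
  mul_mem' := by
    rintro a b ⟨n, ha, ha'⟩ ⟨m, hb, hb'⟩
    refine ⟨n + m, ?_, ?_⟩
    · rw [pow_add]; exact mul_le_mul' ha hb
    · rw [pow_add, mul_inv]; exact mul_le_mul' ha' hb'
  inv_mem' := by
    rintro a ⟨n, ha, ha'⟩
    exact ⟨n, le_inv_of_le_inv ha', inv_le_inv' ha⟩

theorem isConvexSubgroup_convexClosure {G : Type*} [CommGroup G] [LinearOrder G]
    [IsOrderedMonoid G] {g : G} (hg : g ≤ 1) : IsConvexSubgroup (convexClosure g) := by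
  rintro a b ⟨n, -, hn⟩ ha hab
  exact ⟨n, (pow_le_one' hg n).trans ha, hab.trans hn⟩

section

variable {K : Type*} [Field K] {A : ValuationSubring K}

theorem ValuationSubring.exists_unit_eq_valuation (A : ValuationSubring K) {x : K} (hx : x ≠ 0) :
    ∃ g : (A.ValueGroup)ˣ, (g : A.ValueGroup) = A.valuation x :=
  ⟨Units.mk0 _ ((A.valuation.ne_zero_iff).2 hx), rfl⟩

theorem ValuationSubring.exists_valuation_eq_unit (g : (A.ValueGroup)ˣ) :
    ∃ x : K, x ≠ 0 ∧ A.valuation x = g := by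
  obtain ⟨x, hx⟩ := A.valuation_surjective g
  exact ⟨x, (A.valuation.ne_zero_iff).1 (hx ▸ g.ne_zero), hx⟩

theorem ValuationSubring.div_mem_iff {x y : K} (hy : y ≠ 0) :
    x / y ∈ A ↔ A.valuation x ≤ A.valuation y := by
  rw [← A.valuation_le_one_iff, map_div₀,
    div_le_one₀ (zero_lt_iff.2 ((A.valuation.ne_zero_iff).2 hy))]

/-- The smallest nonzero convex subgroup lies in the one generated by the value of `y`, and it
contains that of `p`. -/
theorem IsTight.exists_pow_div_mem {p : ℕ} (h : IsTight A p) (hp : (p : K) ≠ 0) {y : K}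
    (hy : A.valuation y < 1) : ∃ n : ℕ, y ^ (n + 1) / p ∈ A := by
  by_cases hy0 : y = 0
  · exact ⟨0, by simp [hy0]⟩
  obtain ⟨Δ, hΔ, γ, hγ, hγp⟩ := h
  obtain ⟨g, hg⟩ := A.exists_unit_eq_valuation hy0
  have hg1 : g ≤ 1 := by
    rw [← Units.val_le_val, hg]
    exact hy.le
  have hne : convexClosure g ≠ ⊥ := by
    intro h0
    have hmem : g ∈ convexClosure g := ⟨1, by simp, by
      rw [pow_one]; exact hg1.trans (one_le_inv'.2 hg1)⟩
    rw [h0, Subgroup.mem_bot] at hmem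
    rw [← hg, hmem] at hy
    simp at hy
  obtain ⟨n, hn, -⟩ := hΔ.2 ⟨isConvexSubgroup_convexClosure hg1, hne⟩ hγ
  refine ⟨n, ?_⟩
  rw [ValuationSubring.div_mem_iff hp, ← hγp, map_pow, ← hg]
  have : g ^ (n + 1) ≤ γ := (pow_le_pow_right_of_le_one' hg1 n.le_succ).trans hn
  exact_mod_cast this

/-- By `h₂` every nontrivial convex subgroup contains the value of `t`; by `h₁` it is then
everything. -/
theorem isRankOneValuation_of_exists_pow {t : K} (ht : t ∈ A) (ht0 : t ≠ 0)
    (h₁ : ∀ x : K, x ≠ 0 → ∃ n : ℕ, x / t ^ n ∉ A)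
    (h₂ : ∀ y : K, A.valuation y < 1 → ∃ n : ℕ, y ^ (n + 1) / t ∈ A) :
    A ≠ ⊤ ∧ IsRankOneValuation A := by
  obtain ⟨τ, hτ⟩ := A.exists_unit_eq_valuation ht0
  have hA : A ≠ ⊤ := by
    rintro rfl
    obtain ⟨n, hn⟩ := h₁ 1 one_ne_zero
    exact hn trivial
  refine ⟨hA, fun H => ⟨fun ⟨hH, hT⟩ => ?_, ?_⟩⟩
  · by_contra hb
    apply hT
    obtain ⟨h, hhH, hh1⟩ : ∃ h ∈ H, h < 1 := by
      obtain ⟨h, hh, hne⟩ := H.bot_or_exists_ne_one.resolve_left hb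
      rcases lt_or_gt_of_ne hne with hlt | hlt
      · exact ⟨h, hh, hlt⟩
      · exact ⟨h⁻¹, H.inv_mem hh, inv_lt_one'.2 hlt⟩
    have hτ1 : τ ≤ 1 := by
      rw [← Units.val_le_val, hτ]
      exact (A.valuation_le_one_iff t).2 ht
    have hτH : τ ∈ H := by
      obtain ⟨y, hy0, hy⟩ := ValuationSubring.exists_valuation_eq_unit h
      obtain ⟨n, hn⟩ := h₂ y (by rw [hy]; exact_mod_cast hh1)
      rw [ValuationSubring.div_mem_iff ht0, map_pow, hy, ← hτ] at hn
      have hn' : h ^ (n + 1) ≤ τ := by exact_mod_cast hn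
      exact H.inv_mem_iff.1 (hH _ _ (H.inv_mem (H.pow_mem hhH (n + 1))) (one_le_inv'.2 hτ1)
        (inv_le_inv' hn'))
    have hle : ∀ g : (A.ValueGroup)ˣ, g ≤ 1 → g ∈ H := by
      intro g hg
      obtain ⟨x, hx0, hx⟩ := ValuationSubring.exists_valuation_eq_unit g
      obtain ⟨n, hn⟩ := h₁ x hx0
      rw [ValuationSubring.div_mem_iff (pow_ne_zero _ ht0), not_le, map_pow, hx, ← hτ] at hn
      have hn' : τ ^ n < g := by exact_mod_cast hn
      exact H.inv_mem_iff.1 (hH _ _ (H.inv_mem (H.pow_mem hτH n)) (one_le_inv'.2 hg)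
        (inv_le_inv' hn'.le))
    refine eq_top_iff.2 fun g _ => ?_
    rcases le_total g 1 with hg | hg
    · exact hle g hg
    · exact H.inv_mem_iff.1 (hle _ (inv_le_one'.2 hg))
  · rintro rfl
    refine ⟨fun a b hb ha hab => ?_, fun htop => ?_⟩
    · rw [Subgroup.mem_bot] at hb ⊢
      exact le_antisymm (hb ▸ hab) ha
    · have h1 : τ = 1 := by
        rw [← Subgroup.mem_bot, htop]
        trivial
      obtain ⟨n, hn⟩ := h₁ 1 one_ne_zero
      refine hn ((ValuationSubring.div_mem_iff (pow_ne_zero _ ht0)).2 ?_)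
      rw [map_pow, ← hτ, h1]
      simp

end

/-! ### Macintyre formulas for the axioms and the types -/

/-- The inclusion of the language of rings into the Macintyre language. -/
def ringToMac : Language.ring →ᴸ macLang where
  onFunction := fun _ f => f
  onRelation := fun _ r => nomatch r

/-- The formula saying that the value of a term lies in the valuation ring. -/
def memValRing {α : Type*} {n : ℕ} (t : macLang.Term (α ⊕ Fin n)) : macLang.BoundedFormula α n :=
  Language.Relations.boundedFormula₁ (L := macLang) MacRel.valRing t

/-- The formula saying that the value of a term is a nonzero `n`-th power. -/
def memPow {α : Type*} {k : ℕ} (n : ℕ) (hn : 1 < n) (t : macLang.Term (α ⊕ Fin k)) :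
    macLang.BoundedFormula α k :=
  Language.Relations.boundedFormula₁ (L := macLang) (MacRel.pow n hn) t

/-- A polynomial expression as a term of the Macintyre language. -/
noncomputable def macTerm {α : Type*} (f : FreeCommRing α) : macLang.Term α :=
  ringToMac.onTerm (Ring.termOfFreeCommRing f)

section

variable {M : Type*} [macLang.Structure M]

variable (M) in
/-- The interpretation of the predicate for the valuation ring. -/
def valRingSet : Set M :=
  {x | Language.Structure.RelMap (L := macLang) (MacRel.valRing : macLang.Relations 1) ![x]}

@[simp]
theorem realize_memValRing {α : Type*} {n : ℕ} (t : macLang.Term (α ⊕ Fin n)) (v : α → M)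
    (x : Fin n → M) :
    (memValRing t).Realize v x ↔ t.realize (Sum.elim v x) ∈ valRingSet M :=
  Language.BoundedFormula.realize_rel₁

@[simp]
theorem realize_memPow {α : Type*} {k : ℕ} (n : ℕ) (hn : 1 < n) (t : macLang.Term (α ⊕ Fin k))
    (v : α → M) (x : Fin k → M) :
    (memPow n hn t).Realize v x ↔
      Language.Structure.RelMap (L := macLang) (MacRel.pow n hn : macLang.Relations 1)
        ![t.realize (Sum.elim v x)] :=
  Language.BoundedFormula.realize_rel₁

variable [Field M] [Ring.CompatibleRing M] [ringToMac.IsExpansionOn M]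

@[simp]
theorem realize_macTerm {α : Type*} (f : FreeCommRing α) (v : α → M) :
    (macTerm f).realize v = FreeCommRing.lift v f := by
  rw [macTerm, Language.LHom.realize_onTerm, Ring.realize_termOfFreeCommRing]

open Language.BoundedFormula FreeCommRing in
/-- The sentence saying that the predicate for the valuation ring is closed under subtraction and
multiplication and contains `1` and `x` or `x⁻¹` for every nonzero `x`. -/
noncomputable def valRingAxiom : macLang.Sentence :=
  memValRing (macTerm 1) ⊓
  (∀' ∀' (memValRing (macTerm (of (Sum.inr 0))) ⟹ memValRing (macTerm (of (Sum.inr 1))) ⟹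
    (memValRing (macTerm (of (Sum.inr 0) - of (Sum.inr 1))) ⊓
      memValRing (macTerm (of (Sum.inr 0) * of (Sum.inr 1)))))) ⊓
  ∀' (memValRing (macTerm (of (Sum.inr 0))) ⊔
    ∃' (memValRing (macTerm (of (Sum.inr 1))) ⊓
      (macTerm (of (Sum.inr 0) * of (Sum.inr 1))).bdEqual (macTerm 1)))

theorem realize_valRingAxiom : M ⊨ valRingAxiom ↔
    ((1 : M) ∈ valRingSet M ∧ ∀ x y : M, x ∈ valRingSet M → y ∈ valRingSet M →
      x - y ∈ valRingSet M ∧ x * y ∈ valRingSet M) ∧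
    ∀ x : M, x ∈ valRingSet M ∨ ∃ y ∈ valRingSet M, x * y = 1 := by
  simp [valRingAxiom, Language.Sentence.Realize, Language.Formula.Realize, Fin.snoc]

open Language.BoundedFormula FreeCommRing in
/-- The sentence saying that `P_n` is the set of nonzero `n`-th powers. -/
noncomputable def powAxiom (n : ℕ) (hn : 1 < n) : macLang.Sentence :=
  ∀' ((memPow n hn (macTerm (of (Sum.inr 0)))).iff
    (∼((macTerm (of (Sum.inr 0))).bdEqual (macTerm 0)) ⊓
      ∃' ((macTerm (of (Sum.inr 1) ^ n)).bdEqual (macTerm (of (Sum.inr 0))))))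

theorem realize_powAxiom (n : ℕ) (hn : 1 < n) : M ⊨ powAxiom n hn ↔
    ∀ x : M, Language.Structure.RelMap (L := macLang) (MacRel.pow n hn : macLang.Relations 1) ![x] ↔
      x ≠ 0 ∧ ∃ y : M, y ^ n = x := by
  simp [powAxiom, Language.Sentence.Realize, Language.Formula.Realize, Fin.snoc]

open FreeCommRing in
/-- The formula saying that `x` is zero or not divisible by `p ^ n` in the valuation ring. -/
noncomputable def notDivPowFormula (p n : ℕ) : macLang.Formula (Fin 1) :=
  (macTerm (of (Sum.inl 0))).bdEqual (macTerm 0) ⊔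
    ∼(∃' (memValRing (macTerm (of (Sum.inr 0))) ⊓
      (macTerm (of (Sum.inl 0))).bdEqual (macTerm (of (Sum.inr 0) * (p : FreeCommRing _) ^ n))))

theorem realize_notDivPowFormula (p n : ℕ) (x : Fin 1 → M) :
    (notDivPowFormula p n).Realize x ↔
      x 0 = 0 ∨ ¬ ∃ w ∈ valRingSet M, x 0 = w * (p : M) ^ n := by
  simp [notDivPowFormula, Language.Formula.Realize, Fin.snoc]

open FreeCommRing in
/-- The formula saying that `x` is invertible in the valuation ring up to a factor from it, or that
`x ^ (n + 1)` is divisible by `p`. -/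
noncomputable def powDivFormula (p n : ℕ) : macLang.Formula (Fin 1) :=
  (∃' (memValRing (macTerm (of (Sum.inr 0))) ⊓
      (macTerm (of (Sum.inl 0) * of (Sum.inr 0))).bdEqual (macTerm 1))) ⊔
    (∃' (memValRing (macTerm (of (Sum.inr 0))) ⊓
      (macTerm (of (Sum.inl 0) ^ (n + 1))).bdEqual
        (macTerm (of (Sum.inr 0) * (p : FreeCommRing _)))))

theorem realize_powDivFormula (p n : ℕ) (x : Fin 1 → M) :
    (powDivFormula p n).Realize x ↔
      (∃ w ∈ valRingSet M, x 0 * w = 1) ∨ ∃ w ∈ valRingSet M, x 0 ^ (n + 1) = w * (p : M) := by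
  simp [powDivFormula, Language.Formula.Realize, Fin.snoc]

open FreeCommRing in
/-- The formula saying that `z` is a nonzero multiple of an element satisfying `θ`. -/
noncomputable def multipleFormula (θ : macLang.Formula (Fin 1)) : macLang.Formula (Fin 1) :=
  Language.Formula.iExs (Fin 2)
    (∼((macTerm (of (Sum.inl (Sum.inl 0)))).bdEqual (macTerm 0)) ⊓
      θ.relabel (fun _ => Sum.inr 0) ⊓
      memValRing (macTerm (of (Sum.inl (Sum.inr 1)))) ⊓
      (macTerm (of (Sum.inl (Sum.inl 0)))).bdEqual
        (macTerm (of (Sum.inl (Sum.inr 1)) * of (Sum.inl (Sum.inr 0)))))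

theorem realize_multipleFormula (θ : macLang.Formula (Fin 1)) (z : Fin 1 → M) :
    (multipleFormula θ).Realize z ↔
      z 0 ≠ 0 ∧ ∃ x : M, θ.Realize (fun _ => x) ∧ ∃ w ∈ valRingSet M, z 0 = w * x := by
  have hθ : ∀ v : Fin 1 ⊕ Fin 2 → M, Language.BoundedFormula.Realize
      (θ.relabel (fun _ => (Sum.inr 0 : Fin 1 ⊕ Fin 2))) v default ↔
      θ.Realize (fun _ => v (Sum.inr 0)) := fun v => Language.Formula.realize_relabel
  rw [multipleFormula, Language.Formula.realize_iExs]
  simp [Language.Formula.Realize] at hθ ⊢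
  simp [hθ]
  constructor
  · rintro ⟨i, ⟨⟨h0, hi⟩, hw⟩, he⟩
    exact ⟨h0, i 0, hi, i 1, hw, he⟩
  · rintro ⟨h0, x, hx, w, hw, he⟩
    exact ⟨![x, w], ⟨⟨h0, hx⟩, hw⟩, he⟩

end

instance : Countable macLang.Symbols := by
  have h₁ : Countable (Σ l, macLang.Functions l) :=
    inferInstanceAs (Countable (Σ l, Language.ring.Functions l))
  have h₂ : ∀ l, Countable (macLang.Relations l) := by
    intro l
    let f : MacRel l → ℕ := fun r => match r with
      | .valRing => 0
      | .pow n _ => n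
    refine Function.Injective.countable (f := f) ?_
    rintro (_ | ⟨n, hn⟩) r' h
    · rcases r' with _ | ⟨m, hm⟩
      · rfl
      · change 0 = m at h
        omega
    · rcases r' with _ | ⟨m, hm⟩
      · change n = 0 at h
        omega
      · change n = m at h
        subst h
        rfl
  exact inferInstanceAs (Countable ((Σ l, macLang.Functions l) ⊕ (Σ l, macLang.Relations l)))

/-! ### Models as valued fields, and non-isolation of the types -/

section

variable {K : Type u} [Field K] (A : ValuationSubring K)

theorem isExpansionOn_macStructure :
    let _ := macStructure A
    let _ := Ring.compatibleRingOfRing K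
    ringToMac.IsExpansionOn K :=
  let _ := macStructure A
  let _ := Ring.compatibleRingOfRing K
  ⟨fun _ _ => rfl, fun r _ => nomatch r⟩

/-- Being a field of characteristic 0 with a valuation ring and the correct `P_n` is first-order. -/
theorem exists_eq_macStructure [CharZero K] {N : Type*} [S : macLang.Structure N]
    (h : let _ := macStructure A; macLang.ElementarilyEquivalent N K) :
    ∃ (_ : Field N) (_ : CharZero N) (B : ValuationSubring N), macStructure B = S := by
  let _ := macStructure A
  let _ := Ring.compatibleRingOfRing K
  have := isExpansionOn_macStructure A
  have key := Language.elementarilyEquivalent_iff.1 h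
  let _ : Language.ring.Structure N := ringToMac.reduct N
  have hmod : (Language.Theory.fieldOfChar 0).Model N := by
    refine ⟨fun φ hφ => (ringToMac.realize_onSentence N φ).1 ((key _).2
      ((ringToMac.realize_onSentence K φ).2 ?_))⟩
    exact Language.Theory.realize_sentence_of_mem (Language.Theory.fieldOfChar 0) hφ
  have hfield : Language.Theory.field.Model N := hmod.mono Set.subset_union_left
  let _ : Field N := Field.fieldOfModelField N
  let _ : Ring.CompatibleRing N := Field.compatibleRingOfModelField N
  have hexp : ringToMac.IsExpansionOn N := ⟨fun _ _ => rfl, fun r _ => nomatch r⟩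
  have hchar : CharP N 0 := Field.charP_of_model_fieldOfChar 0 N
  have hval : N ⊨ valRingAxiom := by
    rw [key, realize_valRingAxiom]
    refine ⟨⟨A.one_mem, fun x y hx hy => ⟨A.toSubring.sub_mem hx hy, A.mul_mem x y hx hy⟩⟩,
      fun x => ?_⟩
    by_cases h0 : x = 0
    · exact Or.inl (h0 ▸ A.zero_mem)
    · exact (A.mem_or_inv_mem x).imp id fun h => ⟨x⁻¹, h, mul_inv_cancel₀ h0⟩
  obtain ⟨⟨h1, hcl⟩, hinv⟩ := realize_valRingAxiom.1 hval
  have h0 : (0 : N) ∈ valRingSet N := by simpa using (hcl 1 1 h1 h1).1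
  have hneg : ∀ x : N, x ∈ valRingSet N → -x ∈ valRingSet N := fun x hx => by
    simpa using (hcl 0 x h0 hx).1
  let B : ValuationSubring N :=
    { carrier := valRingSet N
      mul_mem' := fun {x y} hx hy => (hcl x y hx hy).2
      one_mem' := h1
      add_mem' := fun {x y} hx hy => by simpa using (hcl x (-y) hx (hneg y hy)).1
      zero_mem' := h0
      neg_mem' := fun {x} hx => hneg x hx
      mem_or_inv_mem' := fun x => (hinv x).imp id fun ⟨y, hy, hxy⟩ => by
        rwa [inv_eq_of_mul_eq_one_right hxy] }
  refine ⟨inferInstance, CharP.charP_to_charZero N, B, ?_⟩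
  have hvec : ∀ x : Fin 1 → N, ![x 0] = x := fun x => funext fun i => by
    rw [Subsingleton.elim i 0]; rfl
  refine Language.Structure.ext ?_ ?_
  · funext n f x
    cases f with
    | add => exact (Ring.CompatibleRing.funMap_add (R := N) x).symm
    | mul => exact (Ring.CompatibleRing.funMap_mul (R := N) x).symm
    | neg => exact (Ring.CompatibleRing.funMap_neg (R := N) x).symm
    | zero => exact (Ring.CompatibleRing.funMap_zero (R := N) x).symm
    | one => exact (Ring.CompatibleRing.funMap_one (R := N) x).symm
  · funext n r x
    cases r with
    | valRing =>
      change (x 0 ∈ valRingSet N) = _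
      rw [valRingSet, Set.mem_ofPred_eq, hvec]
    | pow n hn =>
      have hpow : N ⊨ powAxiom n hn := by
        rw [key, realize_powAxiom]
        exact fun x => Iff.rfl
      have := (realize_powAxiom n hn).1 hpow (x 0)
      rw [hvec] at this
      exact propext this.symm

variable {A}

/-- Quantifier elimination is applied to `multipleFormula θ`, not to `θ`: the truth value of `ψ` is
controlled only at `M`-th powers, and the multiples of realizations include their powers. -/
theorem exists_realize_notDivPowFormula [CharZero K] {p : ℕ}
    (hp : 0 < p) (hchar : CharP (IsLocalRing.ResidueField A) p)
    (hQE : HasQE (macTheory A)) (hpro : IsProhenselianOfDegree A 1)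
    (θ : macLang.Formula (Fin 1)) :
    let _ := macStructure A
    (∃ x : Fin 1 → K, θ.Realize x) →
      ∃ (n : ℕ) (x : Fin 1 → K), θ.Realize x ∧ (notDivPowFormula p n).Realize x := by
  intro _
  let _ := Ring.compatibleRingOfRing K
  have := isExpansionOn_macStructure A
  have hpK : (p : K) ≠ 0 := Nat.cast_ne_zero.2 hp.ne'
  rintro ⟨x, hx⟩
  by_contra! hcon
  have hdom : ∀ x : Fin 1 → K, θ.Realize x → A.Dominates (p : K) (x 0) := by
    intro x hx
    have h := fun n => hcon n x hx
    simp only [realize_notDivPowFormula, not_or, not_not] at h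
    refine ⟨(h 0).1, fun n => ?_⟩
    obtain ⟨w, hw, he⟩ := (h n).2
    rw [he, mul_div_cancel_right₀ _ (pow_ne_zero _ hpK)]
    exact hw
  obtain ⟨ψ, hψ, hiff⟩ := hQE 1 (multipleFormula θ)
  have hmodel : K ⊨ macTheory A := inferInstanceAs (K ⊨ macLang.completeTheory K)
  have hiff' : ∀ z : K, (multipleFormula θ).Realize (fun _ => z) ↔ ψ.Realize (fun _ => z) :=
    fun z => Language.Theory.Iff.realize_iff hiff
  obtain ⟨M, b, hM, hb, j, hj⟩ := exists_eventually_realize_iff_of_isQF hpro hchar hp hψ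
  have hx0 := hdom x hx
  have hx1 : (fun _ => x 0) = x := funext fun i => by rw [Subsingleton.elim i 0]
  have hbt : b := by
    rw [← hb _ hx0]
    refine (hiff' _).1 ((realize_multipleFormula θ _).2 ⟨pow_ne_zero _ hx0.1, x 0, ?_,
      x 0 ^ (M - 1), ?_, ?_⟩)
    · rwa [hx1]
    · exact (pow_mem hx0.mem (M - 1) : x 0 ^ (M - 1) ∈ A)
    · rw [← pow_succ, Nat.sub_add_cancel hM]
  -- The truth value transfers to a power of `p`, which becomes a multiple of a realization of `θ`
  -- and hence divisible by all powers of `p`.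
  obtain ⟨-, y, hy, w, hw, he⟩ :=
    (realize_multipleFormula θ _).1 ((hiff' _).2 ((hj j le_rfl).2 hbt))
  have hd : A.Dominates (p : K) ((p : K) ^ (M * j)) := by
    have hw0 : w ≠ 0 := by
      rintro rfl
      rw [zero_mul] at he
      exact pow_ne_zero _ hpK he
    rw [he, mul_comm]
    exact (hdom _ hy).mul hw hw0
  have hinv : (p : K)⁻¹ ∈ A := by
    have := hd.2 (M * j + 1)
    rwa [pow_succ, ← div_div, div_self (pow_ne_zero _ hpK), one_div] at this
  have h1 := ValuationSubring.valuation_natCast_lt_one (K := K) hchar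
  rw [← A.valuation_le_one_iff, map_inv₀, inv_le_one₀
    (zero_lt_iff.2 ((A.valuation.ne_zero_iff).2 hpK))] at hinv
  exact h1.not_ge hinv

theorem exists_realize_powDivFormula [CharZero K] {p : ℕ} (hp : 0 < p) (htight : IsTight A p)
    (x : Fin 1 → K) :
    let _ := macStructure A
    ∃ n : ℕ, (powDivFormula p n).Realize x := by
  intro _
  let _ := Ring.compatibleRingOfRing K
  have := isExpansionOn_macStructure A
  have hpK : (p : K) ≠ 0 := Nat.cast_ne_zero.2 hp.ne'
  simp only [realize_powDivFormula]
  by_cases hx : A.valuation (x 0) < 1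
  · obtain ⟨n, hn⟩ := htight.exists_pow_div_mem hpK hx
    exact ⟨n, Or.inr ⟨_, hn, (div_mul_cancel₀ _ hpK).symm⟩⟩
  · refine ⟨0, Or.inl ⟨(x 0)⁻¹, ?_, mul_inv_cancel₀ ?_⟩⟩
    · change (x 0)⁻¹ ∈ A
      rw [← A.valuation_le_one_iff, map_inv₀]
      exact inv_le_one_of_one_le₀ (not_lt.1 hx)
    · intro h0
      simp [h0] at hx

end

theorem mainTheorem6 {K : Type u} [Field K] [CharZero K] (A : ValuationSubring K)
    (hA : A ≠ ⊤) (p : ℕ) (hp : 0 < p) (hchar : CharP (IsLocalRing.ResidueField A) p)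
    (hQE : HasQE (macTheory A))
    (hpro : IsProhenselianOfDegree A 1)
    (htight : IsTight A p)
    (hcons : ∃ C : Subgroup Kˣ, IsConservative A p C) :
    ∃ (L : Type u) (_ : Field L) (_ : CharZero L) (B : ValuationSubring L),
      B ≠ ⊤ ∧ IsRankOneValuation B ∧ MacEquiv B A := by
  let _ := macStructure A
  obtain ⟨L, S, hLK, hL⟩ := Language.exists_elementarilyEquivalent_omitting (L := macLang) (M := K)
    (ι := Bool) (fun i n => if i then notDivPowFormula p n else powDivFormula p n) (by
      rintro (_ | _) θ hθ
      · obtain ⟨x, hx⟩ := hθ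
        obtain ⟨n, hn⟩ := exists_realize_powDivFormula hp htight x
        exact ⟨n, x, hx, by simpa using hn⟩
      · simpa using exists_realize_notDivPowFormula hp hchar hQE hpro θ hθ)
  obtain ⟨_, _, B, rfl⟩ := exists_eq_macStructure A hLK
  let _ := macStructure B
  let _ := Ring.compatibleRingOfRing L
  have := isExpansionOn_macStructure B
  have hpL : (p : L) ≠ 0 := Nat.cast_ne_zero.2 hp.ne'
  have hrank := isRankOneValuation_of_exists_pow (natCast_mem B p) hpL (fun x hx => ?_)
    (fun y hy => ?_)
  · exact ⟨L, inferInstance, inferInstance, B, hrank.1, hrank.2, hLK⟩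
  · obtain ⟨n, hn⟩ := hL true fun _ => x
    rw [if_pos rfl, realize_notDivPowFormula] at hn
    exact ⟨n, fun hB => (hn.resolve_left hx) ⟨_, hB, (div_mul_cancel₀ _ (pow_ne_zero _ hpL)).symm⟩⟩
  · obtain ⟨n, hn⟩ := hL false fun _ => y
    rw [if_neg (by simp), realize_powDivFormula] at hn
    refine ⟨n, ?_⟩
    rcases hn with ⟨w, hw, he⟩ | ⟨w, hw, he⟩
    · exfalso
      have h1 := congrArg B.valuation he
      rw [map_mul, map_one] at h1
      exact (mul_lt_one_of_lt_of_le hy ((B.valuation_le_one_iff w).2 hw)).ne h1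
    · rw [he, mul_div_cancel_right₀ _ hpL]
      exact hw
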